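/- Let $q$ be a prime power, let $m \ge 1$ and $s \ge 0$ be integers, and let $1 \le \ell_1 < \ell_2 < \cdots < \ell_s < \frac m2$ be integers. Let $\mathcal{L} = \langle x^{q^{\ell_1}}, \ldots, x^{q^{\ell_s}} \rangle$ be the $\mathbb{F}_{q^m}$-subspace of $\mathbb{F}_{q^m}[x]$ spanned by these monomials, and for $R \in \mathcal{L}$ let $Q_R(x) = \mathrm{Tr}_{q^m/q}(xR(x))$, a quadratic form on the $\mathbb{F}_q$-vector space $\mathbb{F}_{q^m}$. The rank of a quadratic form $Q$ on $\mathbb{F}_{q^m}$ is the codimension of $\{y : Q(y)=0,\ Q(x+y)=Q(x) \text{ for all } x\}$. A quadratic form of even rank $r$ is of type $+1$ if in suitable linear coordinates it is $u_1v_1+\cdots+u_{r/2}v_{r/2}$, and of type $-1$ if in suitable linear coordinates it is $u_1v_1+\cdots+u_{r/2-1}v_{r/2-1}+N(y,z)$ with $N$ an anisotropic binary quadratic form. Assume that $\mathcal{L}$ is an even rank family, i.e. $Q_R$ has even rank for every $R \in \mathcal{L}$. Let $R_{\mathcal{L}}$ be the set of ranks of the forms $Q_R$, $R \in \mathcal{L}$,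 and let $M_{r,1}$ (resp. $M_{r,2}$) be the number of $R \in \mathcal{L}\smallsetminus\{0\}$ for which $Q_R$ has rank $r$ and type $+1$ (resp. type $-1$). Consider the codes of length $q^m-1$ over $\mathbb{F}_q$ $$\mathcal{C}_{\mathcal{L}} = \big\{ (\mathrm{Tr}_{q^m/q}(xR(x)))_{x \in \mathbb{F}_{q^m}^*} : R \in \mathcal{L} \big\}, \qquad \mathcal{C}_{\mathcal{L},0} = \big\{ (\mathrm{Tr}_{q^m/q}(xR(x)) + b)_{x \in \mathbb{F}_{q^m}^*} : R \in \mathcal{L},\ b \in \mathbb{F}_q \big\}.$$ Then $\mathcal{C}_{\mathcal{L}}$ and $\mathcal{C}_{\mathcal{L},0}$ are cyclic (with the coordinates ordered as $1, \alpha, \alpha^2, \ldots, \alpha^{q^m-2}$ for any generator $\alpha$ of $\mathbb{F}_{q^m}^*$), their dimensions over $\mathbb{F}_q$ are $ms$ and $ms+1$ respectively, and their weight distributions are as follows, where $r$ runs over $R_{\mathcal{L}}$, $i$ over $\{1,2\}$, and the frequencies of rows with equal weights are added. For $\mathcal{C}_{\mathcal{L}}$: - weight $0$ with frequency $1$; -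 weight $q^m - q^{m-1} + (-1)^i (q-1) q^{m-\frac r2-1}$ with frequency $M_{r,i}$. For $\mathcal{C}_{\mathcal{L},0}$: - weight $0$ with frequency $1$; - weight $q^m-1$ with frequency $q-1$; - weight $q^m - q^{m-1} + (-1)^i (q-1) q^{m-\frac r2-1}$ with frequency $M_{r,i}$; - weight $q^m - q^{m-1} + (-1)^{i+1} q^{m-\frac r2-1} - 1$ with frequency $M_{r,i}(q-1)$. No other weights occur. -/

import Mathlib

open Polynomial Module

noncomputable section

namespace TraceCode

section QuadraticForms

variable {F V : Type*} [Field F] [AddCommGroup V] [Module F V]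

/-- The function `Q : V → F` is a quadratic form of rank `r`. The rank is the codimension of the
subspace `{y | Q y = 0 ∧ ∀ x, Q (y + x) = Q x}`, which is Mathlib's `QuadraticMap.radical`
(see `QuadraticMap.mem_radical_iff'`; no assumption on the characteristic). -/
def HasRank (Q : V → F) (r : ℕ) : Prop :=
  ∃ B : QuadraticForm F V, (∀ x, B x = Q x) ∧ finrank F (V ⧸ B.radical) = r

/-- Type `1` (sign `+1`): in suitable linear coordinates on `V`,
`Q = u₁v₁ + ⋯ + uₖvₖ`; the remaining `d` coordinates do not occur. -/
def IsHyperbolicType (Q : V → F) : Prop :=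
  ∃ (k d : ℕ) (e : V ≃ₗ[F] (Fin k → F × F) × (Fin d → F)),
    ∀ x, Q x = ∑ i, ((e x).1 i).1 * ((e x).1 i).2

/-- Type `3` (sign `-1`): in suitable linear coordinates on `V`,
`Q = u₁v₁ + ⋯ + uₖvₖ + N(y, z)` with `N` an anisotropic binary quadratic form;
the remaining `d` coordinates do not occur. -/
def IsEllipticType (Q : V → F) : Prop :=
  ∃ (k d : ℕ) (N : QuadraticForm F (F × F))
    (e : V ≃ₗ[F] (Fin k → F × F) × (F × F) × (Fin d → F)),
    N.Anisotropic ∧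
      ∀ x, Q x = ∑ i, ((e x).1 i).1 * ((e x).1 i).2 + N (e x).2.1

end QuadraticForms

section Codes

variable {F : Type*} [Field F]

/-- A code `C ⊆ F^n` is cyclic: it is closed under
`(c₁, …, cₙ) ↦ (cₙ, c₁, …, cₙ₋₁)`. -/
def IsCyclicCode {n : ℕ} (C : Submodule F (Fin n → F)) : Prop :=
  ∀ c ∈ C, (fun i => c ((finRotate n).symm i)) ∈ C

/-- The frequency `A_w`: the number of codewords of Hamming weight `w`. -/
def frequency {ι : Type*} [Fintype ι] [DecidableEq F] (C : Submodule F (ι → F)) (w : ℕ) : ℕ :=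
  Set.ncard {c : ι → F | c ∈ C ∧ hammingNorm c = w}

end Codes

/-- The `K`-subspace `⟨x^{q^{ℓ₁}}, …, x^{q^{ℓₛ}}⟩` of `K[x]`. -/
def linearizedFamily (K : Type*) [Field K] (q : ℕ) {s : ℕ} (ℓ : Fin s → ℕ) : Submodule K K[X] :=
  Submodule.span K (Set.range fun j => (X : K[X]) ^ q ^ ℓ j)

section TraceForms

variable (F : Type*) {K : Type*} [Field F] [Field K] [Algebra F K]

/-- `Q_R(x) = Tr_{K/F}(x R(x))`. -/
def traceForm (R : K[X]) (x : K) : F := Algebra.trace F K (x * R.eval x)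

/-- `Q_R` has even rank for every `R` in the family. -/
def IsEvenRankFamily (L : Submodule K K[X]) : Prop :=
  ∀ R ∈ L, ∃ r, Even r ∧ HasRank (traceForm F R) r

/-- `K_{r,i}`: the nonzero `R ∈ L` for which `Q_R` has rank `r` and type `1` (for `i = 1`)
or type `3` (for `i = 2`). -/
def rankTypeSet (L : Submodule K K[X]) (r i : ℕ) : Set K[X] :=
  {R | R ∈ L ∧ R ≠ 0 ∧ HasRank (traceForm F R) r ∧
    ((i = 1 ∧ IsHyperbolicType (traceForm F R)) ∨ (i = 2 ∧ IsEllipticType (traceForm F R)))}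

/-- `M_{r,i} = #K_{r,i}`. -/
def rankTypeCount (L : Submodule K K[X]) (r i : ℕ) : ℕ := (rankTypeSet F L r i).ncard

open Classical in
/-- The set of ranks of the forms `Q_R`, `R ∈ L` (a rank is at most `[K : F]`). -/
def rankSet (L : Submodule K K[X]) : Finset ℕ :=
  (Finset.range (finrank F K + 1)).filter fun r => ∃ R ∈ L, HasRank (traceForm F R) r

/-- `C_L = {(Tr(x R(x)))_{x ∈ Kˣ} : R ∈ L}`. -/
def code (L : Submodule K K[X]) : Submodule F (Kˣ → F) where
  carrier := {c | ∃ R ∈ L, c = fun x : Kˣ => traceForm F R x}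
  zero_mem' := ⟨0, L.zero_mem, by ext x; simp [traceForm]⟩
  add_mem' := by
    rintro _ _ ⟨R, hR, rfl⟩ ⟨S, hS, rfl⟩
    exact ⟨R + S, L.add_mem hR hS, by ext x; simp [traceForm, mul_add]⟩
  smul_mem' := by
    rintro a _ ⟨R, hR, rfl⟩
    refine ⟨algebraMap F K a • R, L.smul_mem _ hR, ?_⟩
    ext x
    simp only [traceForm, Pi.smul_apply, Polynomial.eval_smul, ← map_smul]
    rw [algebraMap_smul, mul_smul_comm]

/-- `C_{L,0} = {(Tr(x R(x)) + b)_{x ∈ Kˣ} : R ∈ L, b ∈ F}`. -/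
def code₀ (L : Submodule K K[X]) : Submodule F (Kˣ → F) where
  carrier := {c | ∃ R ∈ L, ∃ b : F, c = fun x : Kˣ => traceForm F R x + b}
  zero_mem' := ⟨0, L.zero_mem, 0, by ext x; simp [traceForm]⟩
  add_mem' := by
    rintro _ _ ⟨R, hR, a, rfl⟩ ⟨S, hS, b, rfl⟩
    exact ⟨R + S, L.add_mem hR hS, a + b, by ext x; simp [traceForm, mul_add]; ring⟩
  smul_mem' := by
    rintro a _ ⟨R, hR, b, rfl⟩
    refine ⟨algebraMap F K a • R, L.smul_mem _ hR, a * b, ?_⟩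
    ext x
    simp only [traceForm, Pi.smul_apply, Polynomial.eval_smul]
    rw [algebraMap_smul, mul_smul_comm, map_smul]
    simp only [smul_eq_mul, mul_add]

/-- A code with coordinates indexed by `Kˣ`, written as a code of length `n` through the
enumeration `α⁰, α¹, …, αⁿ⁻¹` of the coordinates. -/
def orderBy (α : Kˣ) (n : ℕ) (C : Submodule F (Kˣ → F)) : Submodule F (Fin n → F) :=
  C.map (LinearMap.funLeft F F fun i : Fin n => α ^ (i : ℕ))

end TraceForms

end TraceCode

end

/-! The weight of the word `Tr(x R(x)) + b` is read off from the size of the fibre of `Q_R` over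
`-b`. For a form of even rank `r` in dimension `m`, the fibres over nonzero scalars have one common
size and the fibre over `0` exceeds it by `±q^(m - r/2)`, the sign being the type. This excess is
multiplicative over orthogonal sums (`HasExcess.add`): a hyperbolic plane contributes `q`, an
anisotropic plane `-q`, each radical coordinate `q`. Suitable coordinates exist because hyperbolic
planes can be split off until every zero lies in the radical, and Chevalley–Warning then bounds the
anisotropic remainder by dimension 2 (`exists_hyperbolic_or_elliptic_coordinates`).

Dimensions and frequencies can be computed on the parameters `(a, b)` since the encoding is
injective (`encode_injective`). If `Q_R` vanishes, its polarization is a polynomial of degree below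
`q^m` that vanishes on `K`; its exponents `q^ℓⱼ` and `q^(m - ℓⱼ)` are distinct because `ℓⱼ < m/2`,
so `R = 0`. The constant `b` is isolated by summing over `K`. Cyclicity holds because `x ↦ βx` only
rescales the coefficients of `R`. -/

open Polynomial Module

namespace TraceCode

/-! ### Fibre sizes and the multiplicativity of the excess. -/

section Counting

variable {F : Type*} [Field F] [Fintype F] [DecidableEq F]

/-- The fibres of `f : W → F` over the nonzero scalars all have the same size, and the fibre over
zero has `b` more elements. -/
def HasExcess {W : Type*} [Fintype W] (f : W → F) (b : ℤ) : Prop :=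
  ∀ c : F, (Fintype.card F : ℤ) * ∑ x, (if f x = c then (1 : ℤ) else 0) =
    Fintype.card W - b + if c = 0 then (Fintype.card F : ℤ) * b else 0

theorem HasExcess.comp_equiv {W W' : Type*} [Fintype W] [Fintype W'] {f : W → F} {b : ℤ}
    (h : HasExcess f b) (e : W' ≃ W) : HasExcess (fun x => f (e x)) b := by
  intro c
  rw [e.sum_comp (fun x => if f x = c then (1 : ℤ) else 0), Fintype.card_congr e]
  exact h c

/-- The fibre sizes of `f + g` are the convolution of those of `f` and `g`. Each is a constant plus
its excess times the delta at `0`; convolution with a constant is constant, and the deltas multiply.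
-/
theorem HasExcess.add {X Y : Type*} [Fintype X] [Fintype Y] {f : X → F} {g : Y → F} {a b : ℤ}
    (hf : HasExcess f a) (hg : HasExcess g b) :
    HasExcess (fun p : X × Y => f p.1 + g p.2) (a * b) := by
  intro c
  have hq : (Fintype.card F : ℤ) ≠ 0 := by exact_mod_cast Fintype.card_ne_zero
  have h1 : ∀ x : X, (Fintype.card F : ℤ) * ∑ y, (if f x + g y = c then (1 : ℤ) else 0) =
      Fintype.card Y - b + (Fintype.card F : ℤ) * b * if f x = c then 1 else 0 := by
    intro x
    have := hg (c - f x)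
    simp only [eq_sub_iff_add_eq', sub_eq_zero] at this
    rw [this]
    by_cases hc : f x = c
    · simp [hc]
    · simp [hc, Ne.symm hc]
  apply mul_left_cancel₀ hq
  rw [Fintype.sum_prod_type, Finset.mul_sum]
  simp only [h1]
  rw [Finset.sum_add_distrib, ← Finset.mul_sum, mul_add,
    show (Fintype.card F : ℤ) * ((Fintype.card F : ℤ) * b *
      ∑ x, (if f x = c then (1 : ℤ) else 0)) = (Fintype.card F : ℤ) * b *
      ((Fintype.card F : ℤ) * ∑ x, (if f x = c then (1 : ℤ) else 0)) by ring, hf c]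
  simp only [Finset.sum_const, Finset.card_univ, Fintype.card_prod, nsmul_eq_mul, Nat.cast_mul]
  split_ifs <;> ring

theorem hasExcess_zero {W : Type*} [Fintype W] :
    HasExcess (fun _ : W => (0 : F)) (Fintype.card W) := by
  intro c
  by_cases hc : c = 0
  · simp [hc]
  · simp [hc, Ne.symm hc]

theorem hasExcess_mul : HasExcess (fun p : F × F => p.1 * p.2) (Fintype.card F) := by
  intro c
  have h1 : ∀ u : F, ∑ v : F, (if u * v = c then (1 : ℤ) else 0) =
      1 + if u = 0 then ((if c = 0 then (Fintype.card F : ℤ) else 0) - 1) else 0 := by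
    intro u
    by_cases hu : u = 0
    · by_cases hc : c = 0
      · simp [hu, hc]
      · simp [hu, hc, Ne.symm hc]
    · have : ∀ v, u * v = c ↔ v = u⁻¹ * c := fun v => (eq_inv_mul_iff_mul_eq₀ hu).symm
      simp [hu, this]
  rw [Fintype.sum_prod_type]
  simp only [h1, Finset.sum_add_distrib]
  simp only [Finset.sum_const, Finset.card_univ, Fintype.card_prod, nsmul_eq_mul, Nat.cast_mul,
    Finset.sum_ite_eq', Finset.mem_univ, if_true]
  split_ifs <;> ring

theorem hasExcess_sum_mul (k : ℕ) :
    HasExcess (fun x : Fin k → F × F => ∑ i, (x i).1 * (x i).2) ((Fintype.card F : ℤ) ^ k) := by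
  induction k with
  | zero => simpa using hasExcess_zero (F := F) (W := Fin 0 → F × F)
  | succ k ih =>
    have := (hasExcess_mul.add ih).comp_equiv (Fin.consEquiv (fun _ : Fin (k + 1) => F × F)).symm
    rw [pow_succ']
    convert this using 2 with x
    rw [Fin.sum_univ_succ]
    rfl

theorem HasExcess.unique {W : Type*} [Fintype W] {f : W → F} {a b : ℤ}
    (ha : HasExcess f a) (hb : HasExcess f b) : a = b := by
  have := (ha 1).symm.trans (hb 1)
  simpa using this

theorem card_mul_sum_fiber_linear {V : Type*} [Fintype V] [AddCommGroup V] [Module F V]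
    {φ : V →ₗ[F] F} (hφ : φ ≠ 0) (a : F) :
    (Fintype.card F : ℤ) * ∑ x, (if φ x = a then (1 : ℤ) else 0) = Fintype.card V := by
  obtain ⟨w, hw⟩ : ∃ w, φ w = 1 := LinearMap.surjective hφ 1
  have h1 : ∀ c : F, ∑ x, (if φ x = c then (1 : ℤ) else 0) =
      ∑ x, (if φ x = a then (1 : ℤ) else 0) := by
    intro c
    rw [← Equiv.sum_comp (Equiv.addRight ((c - a) • w)) (fun x => if φ x = c then (1 : ℤ) else 0)]
    refine Finset.sum_congr rfl fun x _ => ?_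
    simp [hw, ← eq_sub_iff_add_eq]
  calc _ = ∑ c : F, ∑ x, (if φ x = c then (1 : ℤ) else 0) := by simp [h1]
    _ = _ := by rw [Finset.sum_comm]; simp

end Counting

/-! ### Anisotropic binary forms. -/

section Anisotropic

variable {F V : Type*} [Field F] [AddCommGroup V] [Module F V] {N : QuadraticForm F V}

/-- If `t` were polar to everything, then `2 N(t) = 0` would force characteristic 2, where `N` is
additive along `t` and every scalar is a square; a suitable multiple of `t` then cancels the value
of any `u`. -/
theorem polarBilin_ne_zero_of_anisotropic [Finite F] (hN : N.Anisotropic)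
    (hV : finrank F V = 2) {t : V} (ht : t ≠ 0) : N.polarBilin t ≠ 0 := by
  intro h0
  have hp : ∀ w, QuadraticMap.polar N t w = 0 := fun w => by
    simpa using LinearMap.congr_fun h0 w
  have hNt : N t ≠ 0 := fun h => ht (hN t h)
  have h2 : (2 : F) = 0 := by
    have := hp t
    rw [QuadraticMap.polar_self] at this
    simpa [hNt] using this
  have hc : CharP F 2 := CharTwo.of_one_ne_zero_of_two_eq_zero one_ne_zero h2
  obtain ⟨u, hu⟩ : ∃ u, u ∉ Submodule.span F {t} := by
    by_contra! hall
    have htop : Submodule.span F {t} = ⊤ := eq_top_iff.2 fun x _ => hall x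
    have h1 := finrank_span_singleton (K := F) ht
    rw [htop, finrank_top, hV] at h1
    omega
  -- With `γ² = N u / N t`, `N (γt + u) = γ² N t + N u = 2 N u = 0`.
  obtain ⟨γ, hγ⟩ := FiniteField.isSquare_of_char_two
    (ringChar.eq_iff.2 hc) (N u / N t)
  have hz : N (γ • t + u) = 0 := by
    have h3 : N (γ • t + u) = γ * γ * N t + N u := by
      have h4 := hp u
      rw [QuadraticMap.map_add N, QuadraticMap.map_smul, QuadraticMap.polar_smul_left, h4]
      simp
    rw [h3, ← hγ, div_mul_cancel₀ _ hNt, ← two_mul, h2, zero_mul]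
  have := hN _ hz
  apply hu
  rw [Submodule.mem_span_singleton]
  exact ⟨-γ, by rw [neg_smul]; exact neg_eq_of_add_eq_zero_right this⟩

/-- A second-moment argument: the fibre over `0` is a single point, and the first two moments of the
fibre sizes make the variance over nonzero scalars vanish. The common size is therefore the mean
`(q² - 1)/(q - 1) = q + 1`. -/
theorem hasExcess_of_anisotropic [Fintype F] [DecidableEq F] [Fintype V] (hN : N.Anisotropic)
    (hV : finrank F V = 2) : HasExcess N (-(Fintype.card F : ℤ)) := by
  classical
  set q : ℤ := (Fintype.card F : ℤ) with hq
  have hq0 : q ≠ 0 := by simp [hq]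
  have hcard : (Fintype.card V : ℤ) = q ^ 2 := by
    rw [card_eq_pow_finrank (K := F) (V := V), hV]; simp [hq]
  set n : F → ℤ := fun c => ∑ x, (if N x = c then (1 : ℤ) else 0) with hn
  have hn0 : n 0 = 1 := by
    have : ∀ x, N x = 0 ↔ x = 0 := fun x => ⟨hN x, fun h => by simp [h]⟩
    simp only [hn, this]
    rw [Fintype.sum_eq_single 0 (fun x hx => if_neg hx), if_pos rfl]
  have hsum : ∑ c, n c = q ^ 2 := by
    simp only [hn]
    rw [Finset.sum_comm]; simp [← hcard]
  have hsq : ∑ c, n c ^ 2 = q ^ 3 + q ^ 2 - q := by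
    have e1 : ∑ c, n c ^ 2 = ∑ x : V, ∑ y : V, (if N y = N x then (1 : ℤ) else 0) := by
      simp only [hn, sq, Finset.sum_mul_sum]
      rw [Finset.sum_comm]
      refine Finset.sum_congr rfl fun x _ => ?_
      rw [Finset.sum_comm]
      refine Finset.sum_congr rfl fun y _ => ?_
      simp [eq_comm]
    -- Substituting `y = t + x`, the condition `N y = N x` becomes linear in `x` for each fixed `t`.
    have e2 : ∑ x : V, ∑ y : V, (if N y = N x then (1 : ℤ) else 0) =
        ∑ t : V, ∑ x : V, (if N.polarBilin t x = -N t then (1 : ℤ) else 0) := by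
      rw [Finset.sum_comm (s := (Finset.univ : Finset V)) (t := (Finset.univ : Finset V))
        (f := fun t x => if N.polarBilin t x = -N t then (1 : ℤ) else 0)]
      refine Finset.sum_congr rfl fun x _ => ?_
      rw [← Equiv.sum_comp (Equiv.addRight x)]
      refine Finset.sum_congr rfl fun t _ => ?_
      simp only [Equiv.coe_addRight, QuadraticMap.map_add N, QuadraticMap.polarBilin_apply_apply,
        eq_neg_iff_add_eq_zero]
      congr 1
      rw [eq_iff_iff]
      constructor <;> intro h <;> linear_combination h
    have e3 : ∀ t : V, ∑ x : V, (if N.polarBilin t x = -N t then (1 : ℤ) else 0) =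
        q + if t = 0 then q ^ 2 - q else 0 := by
      intro t
      by_cases ht : t = 0
      · simp [ht, hcard]
      · have := card_mul_sum_fiber_linear (polarBilin_ne_zero_of_anisotropic hN hV ht) (-N t)
        rw [hcard, sq] at this
        simpa [ht] using mul_left_cancel₀ hq0 this
    rw [e1, e2]
    simp only [e3, Finset.sum_add_distrib]
    simp [hcard]
    ring
  have hzero : ∑ c : F, (if c = 0 then 0 else (n c - (q + 1)) ^ 2) = 0 := by
    have : ∀ c : F, (if c = 0 then 0 else (n c - (q + 1)) ^ 2) =
        n c ^ 2 - 2 * (q + 1) * n c + (q + 1) ^ 2 - if c = 0 then q ^ 2 else 0 := by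
      intro c
      by_cases hc : c = 0
      · simp [hc, hn0]; ring
      · simp [hc]; ring
    simp only [this, Finset.sum_sub_distrib, Finset.sum_add_distrib, ← Finset.mul_sum, hsq, hsum]
    simp [← hq]
    ring
  have hall := (Finset.sum_eq_zero_iff_of_nonneg
    (fun c _ => by split_ifs <;> positivity)).1 hzero
  intro c
  change q * n c = _
  rw [hcard]
  by_cases hc : c = 0
  · simp [hc, hn0]; ring
  · have := hall c (Finset.mem_univ _)
    simp only [hc, if_false] at this ⊢
    have := pow_eq_zero_iff (two_ne_zero) |>.1 this
    rw [show n c = q + 1 by linarith]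
    ring

end Anisotropic

/-! ### Splitting off hyperbolic planes over a finite field. -/

section Classification

variable {F : Type*} [Field F]

/-- Chevalley–Warning: a quadratic polynomial in more than two variables has a number of zeros
divisible by the characteristic, so the origin is not the only one. -/
theorem exists_ne_zero_map_eq_zero [Finite F] {V : Type*} [AddCommGroup V] [Module F V]
    (Q : QuadraticForm F V) (hV : 2 < finrank F V) : ∃ v ≠ 0, Q v = 0 := by
  classical
  have := Fintype.ofFinite F
  -- In every characteristic a quadratic form is the diagonal of some bilinear form, not necessarily
  -- symmetric; this gives polynomial coefficients.
  obtain ⟨B, rfl⟩ := LinearMap.BilinMap.toQuadraticMap_surjective Q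
  have : FiniteDimensional F V := FiniteDimensional.of_finrank_pos (by omega)
  let b := finBasis F V
  let f : MvPolynomial (Fin (finrank F V)) F :=
    ∑ i, ∑ j, MvPolynomial.C (B (b i) (b j)) * (MvPolynomial.X i * MvPolynomial.X j)
  have hf : ∀ x : Fin (finrank F V) → F, MvPolynomial.eval x f =
      B (∑ i, x i • b i) (∑ i, x i • b i) := by
    intro x
    simp only [f, map_sum, map_mul, MvPolynomial.eval_C, MvPolynomial.eval_X, LinearMap.sum_apply,
      map_smul, LinearMap.smul_apply, smul_eq_mul, Finset.mul_sum]
    rw [Finset.sum_comm]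
    refine Finset.sum_congr rfl fun i _ => Finset.sum_congr rfl fun j _ => ?_
    ring
  have hdeg : f.totalDegree < Fintype.card (Fin (finrank F V)) := by
    rw [Fintype.card_fin]
    refine lt_of_le_of_lt ?_ hV
    refine (MvPolynomial.totalDegree_finsetSum _ _).trans (Finset.sup_le fun i _ => ?_)
    refine (MvPolynomial.totalDegree_finsetSum _ _).trans (Finset.sup_le fun j _ => ?_)
    refine (MvPolynomial.totalDegree_mul _ _).trans ?_
    rw [MvPolynomial.totalDegree_C, zero_add]
    refine (MvPolynomial.totalDegree_mul _ _).trans ?_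
    simp
  obtain ⟨p, hp⟩ := CharP.exists F
  have hdvd := char_dvd_card_solutions p hdeg
  have hp1 : p ≠ 1 := CharP.char_ne_one F p
  have hcard : Fintype.card {x // MvPolynomial.eval x f = 0} ≠ 1 := by
    intro h
    rw [h] at hdvd
    exact hp1 (Nat.dvd_one.1 hdvd)
  have h0 : MvPolynomial.eval 0 f = 0 := by rw [hf]; simp
  obtain ⟨x, hx⟩ : ∃ x : {x // MvPolynomial.eval x f = 0}, x ≠ ⟨0, h0⟩ := by
    by_contra! hall
    exact hcard (Fintype.card_eq_one_iff.2 ⟨_, hall⟩)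
  refine ⟨∑ i, x.1 i • b i, ?_, ?_⟩
  · intro hz
    apply hx
    ext i
    exact Fintype.linearIndependent_iff.1 b.linearIndependent _ hz i
  · rw [LinearMap.BilinMap.toQuadraticMap_apply, ← hf, x.2]

variable {V : Type*} [AddCommGroup V] [Module F V]

/-- The orthogonal complement of the plane spanned by `v` and `w` for the polar form of `Q`. -/
def orthPair (Q : QuadraticForm F V) (v w : V) : Submodule F V :=
  (Q.polarBilin v).ker ⊓ (Q.polarBilin w).ker

theorem mem_orthPair {Q : QuadraticForm F V} {v w x : V} :
    x ∈ orthPair Q v w ↔ QuadraticMap.polar Q v x = 0 ∧ QuadraticMap.polar Q w x = 0 := by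
  simp [orthPair]

theorem map_hyperbolic_add {Q : QuadraticForm F V} {v w : V} (hv : Q v = 0) (hw : Q w = 0)
    (hvw : QuadraticMap.polar Q v w = 1) (a b : F) {u : V} (hu : u ∈ orthPair Q v w) :
    Q (a • v + b • w + u) = a * b + Q u := by
  obtain ⟨h1, h2⟩ := mem_orthPair.1 hu
  rw [QuadraticMap.map_add Q, QuadraticMap.map_add Q, QuadraticMap.polar_add_left]
  simp only [QuadraticMap.polar_smul_left, QuadraticMap.polar_smul_right, h1, h2, hvw,
    QuadraticMap.map_smul, hv, hw]
  simp [mul_comm]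

/-- The splitting of a hyperbolic plane with hyperbolic pair `v, w`. -/
noncomputable def hyperbolicSplitting {Q : QuadraticForm F V} {v w : V} (hv : Q v = 0) (hw : Q w = 0)
    (hvw : QuadraticMap.polar Q v w = 1) : V ≃ₗ[F] (F × F) × orthPair Q v w :=
  have hwv : QuadraticMap.polar Q w v = 1 := by rw [QuadraticMap.polar_comm, hvw]
  have hvv : QuadraticMap.polar Q v v = 0 := by simp [QuadraticMap.polar_self, hv]
  have hww : QuadraticMap.polar Q w w = 0 := by simp [QuadraticMap.polar_self, hw]
  LinearEquiv.symm <| LinearEquiv.ofBijective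
    (((LinearMap.fst F F F).smulRight v + (LinearMap.snd F F F).smulRight w).coprod
      (orthPair Q v w).subtype) <| by
    constructor
    · rw [← LinearMap.ker_eq_bot, LinearMap.ker_eq_bot']
      rintro ⟨⟨a, b⟩, u, hu⟩ h
      obtain ⟨h1, h2⟩ := mem_orthPair.1 hu
      have h' : a • v + b • w + u = 0 := by simpa using h
      -- Pairing with `w` reads off the coefficient of `v`, and pairing with `v` that of `w`.
      have ha : QuadraticMap.polar Q w (a • v + b • w + u) = a := by
        simp [QuadraticMap.polar_add_right, QuadraticMap.polar_smul_right, hwv, hww, h2]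
      have hb : QuadraticMap.polar Q v (a • v + b • w + u) = b := by
        simp [QuadraticMap.polar_add_right, QuadraticMap.polar_smul_right, hvv, hvw, h1]
      rw [h', QuadraticMap.polar_zero_right] at ha hb
      subst ha hb
      simpa using h'
    · intro x
      refine ⟨((QuadraticMap.polar Q w x, QuadraticMap.polar Q v x),
        ⟨x - QuadraticMap.polar Q w x • v - QuadraticMap.polar Q v x • w, ?_⟩), ?_⟩
      · rw [mem_orthPair]
        constructor
        · simp [QuadraticMap.polar_sub_right, QuadraticMap.polar_smul_right, hvv, hvw]
        · simp [QuadraticMap.polar_sub_right, QuadraticMap.polar_smul_right, hwv, hww]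
      · simp

theorem map_eq_hyperbolicSplitting {Q : QuadraticForm F V} {v w : V} (hv : Q v = 0)
    (hw : Q w = 0) (hvw : QuadraticMap.polar Q v w = 1) (x : V) :
    Q x = (hyperbolicSplitting hv hw hvw x).1.1 * (hyperbolicSplitting hv hw hvw x).1.2 +
      Q.comp (orthPair Q v w).subtype (hyperbolicSplitting hv hw hvw x).2 := by
  obtain ⟨⟨⟨a, b⟩, u⟩, rfl⟩ := (hyperbolicSplitting hv hw hvw).symm.surjective x
  rw [LinearEquiv.apply_symm_apply]
  have : (hyperbolicSplitting hv hw hvw).symm ((a, b), u) = a • v + b • w + u := rfl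
  rw [this, map_hyperbolic_add hv hw hvw a b u.2]
  rfl

theorem mem_radical_iff_polar {Q : QuadraticForm F V} {y : V} :
    y ∈ Q.radical ↔ Q y = 0 ∧ ∀ x, QuadraticMap.polar Q y x = 0 :=
  and_congr_right fun _ => LinearMap.ext_iff

/-- The hyperbolic plane is nondegenerate and orthogonal to its complement, so it contributes
nothing to the radical; hence splitting it off lowers the rank by exactly 2. -/
theorem map_subtype_radical_orthPair {Q : QuadraticForm F V} {v w : V} (hv : Q v = 0)
    (hw : Q w = 0) (hvw : QuadraticMap.polar Q v w = 1) :
    (Q.comp (orthPair Q v w).subtype).radical.map (orthPair Q v w).subtype = Q.radical := by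
  ext y
  simp only [Submodule.mem_map, mem_radical_iff_polar]
  constructor
  · rintro ⟨⟨u, hu⟩, ⟨h1, h2⟩, rfl⟩
    refine ⟨h1, fun x => ?_⟩
    obtain ⟨⟨⟨a, b⟩, t⟩, rfl⟩ := (hyperbolicSplitting hv hw hvw).symm.surjective x
    have ht : (hyperbolicSplitting hv hw hvw).symm ((a, b), t) = a • v + b • w + t := rfl
    have h3 : QuadraticMap.polar Q u t = 0 := h2 t
    obtain ⟨h4, h5⟩ := mem_orthPair.1 hu
    rw [QuadraticMap.polar_comm] at h4 h5
    simp [ht, QuadraticMap.polar_add_right, QuadraticMap.polar_smul_right, h3, h4, h5]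
  · rintro ⟨h1, h2⟩
    refine ⟨⟨y, mem_orthPair.2 ⟨?_, ?_⟩⟩, ⟨h1, fun x => h2 x⟩, rfl⟩
    · rw [QuadraticMap.polar_comm, h2]
    · rw [QuadraticMap.polar_comm, h2]

theorem finrank_radical_orthPair {Q : QuadraticForm F V} {v w : V} (hv : Q v = 0)
    (hw : Q w = 0) (hvw : QuadraticMap.polar Q v w = 1) :
    finrank F (Q.comp (orthPair Q v w).subtype).radical = finrank F Q.radical := by
  rw [← map_subtype_radical_orthPair hv hw hvw]
  exact (Submodule.equivMapOfInjective _ (Submodule.subtype_injective _) _).finrank_eq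

theorem exists_hyperbolic_pair {Q : QuadraticForm F V} {v : V} (hv : Q v = 0)
    (hv' : v ∉ Q.radical) : ∃ w, Q w = 0 ∧ QuadraticMap.polar Q v w = 1 := by
  rw [mem_radical_iff_polar] at hv'
  push Not at hv'
  obtain ⟨x, hx⟩ := hv' hv
  have hvv : QuadraticMap.polar Q v v = 0 := by simp [QuadraticMap.polar_self, hv]
  obtain ⟨y, h1⟩ : ∃ y, QuadraticMap.polar Q v y = 1 :=
    ⟨(QuadraticMap.polar Q v x)⁻¹ • x, by simp [QuadraticMap.polar_smul_right, hx]⟩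
  -- Since `Q v = 0` and `v, y` have polar value 1, `Q (y + t v) = Q y + t`; take `t = -Q y`.
  refine ⟨y + (-Q y) • v, ?_, ?_⟩
  · rw [QuadraticMap.map_add Q, QuadraticMap.map_smul, QuadraticMap.polar_smul_right,
      QuadraticMap.polar_comm Q y v, h1, hv]
    simp
  · rw [QuadraticMap.polar_add_right, QuadraticMap.polar_smul_right, h1, hvv]
    simp

universe u

/-- Classification of quadratic forms of even rank `2 * h` over a finite field. -/
theorem exists_hyperbolic_or_elliptic_coordinates [Finite F] (h d : ℕ) :
    ∀ {V : Type u} [AddCommGroup V] [Module F V] [FiniteDimensional F V] (Q : QuadraticForm F V),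
      finrank F Q.radical = d → finrank F V = 2 * h + d →
      (∃ e : V ≃ₗ[F] (Fin h → F × F) × (Fin d → F),
        ∀ x, Q x = ∑ i, ((e x).1 i).1 * ((e x).1 i).2) ∨
      ∃ (k : ℕ) (N : QuadraticForm F (F × F))
        (e : V ≃ₗ[F] (Fin k → F × F) × (F × F) × (Fin d → F)),
        h = k + 1 ∧ N.Anisotropic ∧
          ∀ x, Q x = ∑ i, ((e x).1 i).1 * ((e x).1 i).2 + N (e x).2.1 := by
  induction h with
  | zero =>
    intro V _ _ _ Q hr hd
    have htop : Q.radical = ⊤ := Submodule.eq_top_of_finrank_eq (by omega)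
    refine Or.inl ⟨(LinearEquiv.ofFinrankEq V (Fin d → F) (by simp [hd])).trans
      (LinearEquiv.uniqueProd (M₂ := Fin 0 → F × F)).symm, fun x => ?_⟩
    have hx : x ∈ Q.radical := htop ▸ Submodule.mem_top
    simpa using hx.1
  | succ h ih =>
    intro V _ _ _ Q hr hd
    by_cases hex : ∃ v, Q v = 0 ∧ v ∉ Q.radical
    · obtain ⟨v, hv, hv'⟩ := hex
      obtain ⟨w, hw, hvw⟩ := exists_hyperbolic_pair hv hv'
      set E := hyperbolicSplitting hv hw hvw with hE
      have hU : finrank F (orthPair Q v w) = 2 * h + d := by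
        have := E.finrank_eq
        rw [finrank_prod, finrank_prod, finrank_self] at this
        omega
      rcases ih (Q.comp (orthPair Q v w).subtype)
        ((finrank_radical_orthPair hv hw hvw).trans hr) hU with ⟨e, he⟩ | ⟨k, N, e, rfl, hN, he⟩
      · refine Or.inl ⟨(E.trans ((LinearEquiv.refl F (F × F)).prodCongr e)).trans
          ((LinearEquiv.prodAssoc F (F × F) (Fin h → F × F) (Fin d → F)).symm.trans
            ((Fin.consLinearEquiv F (fun _ : Fin (h + 1) => F × F)).prodCongr
              (LinearEquiv.refl F (Fin d → F)))), fun x => ?_⟩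
        rw [map_eq_hyperbolicSplitting hv hw hvw, he, Fin.sum_univ_succ]
        rfl
      · refine Or.inr ⟨k + 1, N, (E.trans ((LinearEquiv.refl F (F × F)).prodCongr e)).trans
          ((LinearEquiv.prodAssoc F (F × F) (Fin k → F × F) ((F × F) × (Fin d → F))).symm.trans
            ((Fin.consLinearEquiv F (fun _ : Fin (k + 1) => F × F)).prodCongr
              (LinearEquiv.refl F ((F × F) × (Fin d → F))))), rfl, hN, fun x => ?_⟩
        rw [map_eq_hyperbolicSplitting hv hw hvw, he, Fin.sum_univ_succ, ← add_assoc]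
        rfl
    · push Not at hex
      -- All zeros of `Q` now lie in the radical, so `Q` is anisotropic on any complement of it.
      obtain ⟨W, hW⟩ := Submodule.exists_isCompl Q.radical
      have hanis : (Q.comp W.subtype).Anisotropic := by
        intro x hx
        have h1 : (x : V) ∈ Q.radical := hex x hx
        exact Subtype.ext (Submodule.disjoint_def.1 hW.disjoint _ h1 x.2)
      have hfin : finrank F W = 2 * (h + 1) := by
        have := Submodule.finrank_add_eq_of_isCompl hW
        omega
      -- The complement has dimension `2 * (h + 1)`, so this bound leaves exactly one anisotropic
      -- plane.
      have hle : finrank F W ≤ 2 := by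
        by_contra! hlt
        obtain ⟨x, hx, hx'⟩ := exists_ne_zero_map_eq_zero (Q.comp W.subtype) hlt
        exact hx (hanis x hx')
      obtain rfl : h = 0 := by omega
      let eW : W ≃ₗ[F] F × F := LinearEquiv.ofFinrankEq _ _ (by simp [hfin])
      let eR : Q.radical ≃ₗ[F] (Fin d → F) := LinearEquiv.ofFinrankEq _ _ (by simp [hr])
      let E := W.prodEquivOfIsCompl Q.radical hW.symm
      refine Or.inr ⟨0, (Q.comp W.subtype).comp eW.symm.toLinearMap,
        (E.symm.trans (eW.prodCongr eR)).trans
          (LinearEquiv.uniqueProd (M₂ := Fin 0 → F × F)).symm, rfl, ?_, fun x => ?_⟩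
      · intro x hx
        exact eW.symm.map_eq_zero_iff.1 (hanis _ hx)
      · obtain ⟨⟨a, y⟩, rfl⟩ := E.surjective x
        have h1 : Q (E (a, y)) = Q a := by
          have : E (a, y) = y + a := by simp [E, add_comm]
          rw [this]
          exact (QuadraticMap.mem_radical_iff'.1 y.2).2 a
        rw [h1]
        simp

end Classification

/-! ### Uniqueness and bounds of the rank. -/

section Rank

variable {F V : Type*} [Field F] [AddCommGroup V] [Module F V]

theorem HasRank.unique {Q : V → F} {r r' : ℕ} (h : HasRank Q r) (h' : HasRank Q r') : r = r' := by
  obtain ⟨B, hB, rfl⟩ := h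
  obtain ⟨B', hB', rfl⟩ := h'
  obtain rfl : B = B' := QuadraticMap.ext fun x => (hB x).trans (hB' x).symm
  rfl

theorem HasRank.le_finrank [FiniteDimensional F V] {Q : V → F} {r : ℕ} (h : HasRank Q r) : r ≤ finrank F V := by
  obtain ⟨B, hB, rfl⟩ := h
  exact Submodule.finrank_quotient_le _

end Rank

/-! ### The excess as an invariant of rank and type. -/

section Excess

variable {F V : Type*} [Field F] [AddCommGroup V] [Module F V] [Fintype F] [DecidableEq F]
  [Fintype V]

theorem hasExcess_of_hyperbolic_coordinates {Q : V → F} {k d : ℕ}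
    (e : V ≃ₗ[F] (Fin k → F × F) × (Fin d → F))
    (he : ∀ x, Q x = ∑ i, ((e x).1 i).1 * ((e x).1 i).2) :
    HasExcess Q ((Fintype.card F : ℤ) ^ (k + d)) := by
  have := ((hasExcess_sum_mul (F := F) k).add
    (hasExcess_zero (F := F) (W := Fin d → F))).comp_equiv e.toEquiv
  rw [pow_add]
  convert this using 2 with x
  · simp [he]
  · simp

theorem hasExcess_of_elliptic_coordinates {Q : V → F} {k d : ℕ} {N : QuadraticForm F (F × F)}
    (hN : N.Anisotropic) (e : V ≃ₗ[F] (Fin k → F × F) × (F × F) × (Fin d → F))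
    (he : ∀ x, Q x = ∑ i, ((e x).1 i).1 * ((e x).1 i).2 + N (e x).2.1) :
    HasExcess Q (-(Fintype.card F : ℤ) ^ (k + 1 + d)) := by
  have := ((hasExcess_sum_mul (F := F) k).add ((hasExcess_of_anisotropic hN (by simp)).add
    (hasExcess_zero (F := F) (W := Fin d → F)))).comp_equiv e.toEquiv
  have hpow : -(Fintype.card F : ℤ) ^ (k + 1 + d) = (Fintype.card F : ℤ) ^ k *
    (-(Fintype.card F : ℤ) * (Fintype.card (Fin d → F) : ℕ)) := by
    simp; ring
  rw [hpow]
  convert this using 2 with x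
  simp [he]

/-- The excess is determined by `Q`; it is positive in hyperbolic and negative in elliptic
coordinates. -/
theorem not_isEllipticType_of_isHyperbolicType {Q : V → F} (h : IsHyperbolicType Q) :
    ¬ IsEllipticType Q := by
  rintro ⟨k', d', N, e', hN, he'⟩
  obtain ⟨k, d, e, he⟩ := h
  have := (hasExcess_of_hyperbolic_coordinates e he).unique
    (hasExcess_of_elliptic_coordinates hN e' he')
  have hq : (0 : ℤ) < Fintype.card F := by exact_mod_cast Fintype.card_pos
  have h1 : (0 : ℤ) < (Fintype.card F : ℤ) ^ (k + d) := by positivity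
  have h2 : (0 : ℤ) < (Fintype.card F : ℤ) ^ (k' + 1 + d') := by positivity
  omega

/-- A quadratic form of even rank over a finite field is hyperbolic or elliptic, and the type and
the rank determine the sizes of its fibres. -/
theorem HasRank.type_and_excess {Q : V → F} {r : ℕ} (h : HasRank Q r) (hr : Even r) :
    (IsHyperbolicType Q ∧ HasExcess Q ((Fintype.card F : ℤ) ^ (finrank F V - r / 2))) ∨
    (IsEllipticType Q ∧ HasExcess Q (-(Fintype.card F : ℤ) ^ (finrank F V - r / 2))) := by
  obtain ⟨B, hB, hrank⟩ := h
  obtain ⟨h, rfl⟩ := hr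
  have hsum := B.radical.finrank_quotient_add_finrank
  -- With rank `2h` and a radical of dimension `d`, `m - r/2 = h + d`: one factor `q` per plane and
  -- per radical coordinate.
  have hexp : finrank F V - (h + h) / 2 = h + finrank F B.radical := by omega
  rw [hexp]
  rcases exists_hyperbolic_or_elliptic_coordinates h _ B rfl (by omega) with
    ⟨e, he⟩ | ⟨k, N, e, rfl, hN, he⟩
  · simp only [hB] at he
    exact Or.inl ⟨⟨_, _, e, he⟩, hasExcess_of_hyperbolic_coordinates e he⟩
  · simp only [hB] at he
    exact Or.inr ⟨⟨_, _, N, e, hN, he⟩, hasExcess_of_elliptic_coordinates hN e he⟩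

end Excess

/-! ### Injective parametrization of the codewords. -/

section Parametrization

variable {F K : Type*} [Field F] [Field K] [Algebra F K] {s : ℕ}

/-- The polynomial `∑ aⱼ x ^ q ^ ℓⱼ`. -/
noncomputable def linearizedPoly (q : ℕ) (ℓ : Fin s → ℕ) (a : Fin s → K) : K[X] :=
  ∑ j, a j • (X : K[X]) ^ q ^ ℓ j

theorem linearizedPoly_zero (q : ℕ) (ℓ : Fin s → ℕ) : linearizedPoly q ℓ (0 : Fin s → K) = 0 := by
  simp [linearizedPoly]

theorem mem_linearizedFamily {q : ℕ} {ℓ : Fin s → ℕ} {R : K[X]} :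
    R ∈ linearizedFamily K q ℓ ↔ ∃ a, linearizedPoly q ℓ a = R :=
  Submodule.mem_span_range_iff_exists_fun K

theorem eval_linearizedPoly (q : ℕ) (ℓ : Fin s → ℕ) (a : Fin s → K) (x : K) :
    (linearizedPoly q ℓ a).eval x = ∑ j, a j * x ^ q ^ ℓ j := by
  simp [linearizedPoly, eval_finsetSum]

theorem traceForm_zero_right (R : K[X]) : traceForm F R 0 = 0 := by simp [traceForm]

/-- The encoding map `(a, b) ↦ (Tr(x R(x)) + b)ₓ` with `R = ∑ aⱼ x ^ q ^ ℓⱼ`. -/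
noncomputable def encode (F : Type*) {K : Type*} [Field F] [Field K] [Algebra F K] {s : ℕ} (q : ℕ)
    (ℓ : Fin s → ℕ) : (Fin s → K) × F →ₗ[F] (Kˣ → F) where
  toFun p x := traceForm F (linearizedPoly q ℓ p.1) x + p.2
  map_add' p p' := by
    ext x
    simp [traceForm, eval_linearizedPoly, add_mul, Finset.sum_add_distrib, mul_add]
    ring
  map_smul' c p := by
    ext x
    simp only [traceForm, eval_linearizedPoly, Prod.smul_fst, Prod.smul_snd, Pi.smul_apply,
      smul_mul_assoc, ← Finset.smul_sum, mul_smul_comm, map_smul, RingHom.id_apply, smul_add]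

theorem encode_apply (q : ℕ) (ℓ : Fin s → ℕ) (p : (Fin s → K) × F) (x : Kˣ) :
    encode F q ℓ p x = traceForm F (linearizedPoly q ℓ p.1) x + p.2 := rfl

theorem range_encode (q : ℕ) (ℓ : Fin s → ℕ) :
    LinearMap.range (encode F (K := K) q ℓ) = code₀ F (linearizedFamily K q ℓ) := by
  ext c
  constructor
  · rintro ⟨⟨a, b⟩, rfl⟩
    exact ⟨_, mem_linearizedFamily.2 ⟨a, rfl⟩, b, rfl⟩
  · rintro ⟨R, hR, b, rfl⟩
    obtain ⟨a, rfl⟩ := mem_linearizedFamily.1 hR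
    exact ⟨(a, b), rfl⟩

theorem range_encode_inl (q : ℕ) (ℓ : Fin s → ℕ) :
    LinearMap.range (encode F (K := K) q ℓ ∘ₗ LinearMap.inl F (Fin s → K) F) =
      code F (linearizedFamily K q ℓ) := by
  ext c
  constructor
  · rintro ⟨a, rfl⟩
    exact ⟨_, mem_linearizedFamily.2 ⟨a, rfl⟩, by ext x; simp [encode_apply]⟩
  · rintro ⟨R, hR, rfl⟩
    obtain ⟨a, rfl⟩ := mem_linearizedFamily.1 hR
    exact ⟨a, by ext x; simp [encode_apply]⟩

variable [Fintype F]

theorem eval_linearizedPoly_add (ℓ : Fin s → ℕ) (a : Fin s → K) (x y : K) :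
    (linearizedPoly (Fintype.card F) ℓ a).eval (x + y) =
      (linearizedPoly (Fintype.card F) ℓ a).eval x +
        (linearizedPoly (Fintype.card F) ℓ a).eval y := by
  have h : ∀ n : ℕ, (x + y) ^ Fintype.card F ^ n = x ^ Fintype.card F ^ n +
      y ^ Fintype.card F ^ n := by
    intro n
    have := map_add (FiniteField.frobeniusAlgHom F K ^ n) x y
    simpa only [AlgHom.coe_pow, FiniteField.coe_frobeniusAlgHom, pow_iterate] using this
  simp only [eval_linearizedPoly, h, mul_add, Finset.sum_add_distrib]

variable [Fintype K]

theorem card_eq_card_pow_finrank : Fintype.card K = Fintype.card F ^ finrank F K :=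
  card_eq_pow_finrank

/-- The trace is invariant under Frobenius; the power `m - n` of Frobenius completes `y^(q^n)` to
`y^(q^m) = y`. -/
theorem trace_mul_pow_card_pow {n : ℕ} (hn : n ≤ finrank F K) (a y : K) :
    Algebra.trace F K (a * y ^ Fintype.card F ^ n) =
      Algebra.trace F K (y * a ^ Fintype.card F ^ (finrank F K - n)) := by
  rw [← Algebra.trace_eq_of_algEquiv
    (FiniteField.frobeniusAlgEquivOfAlgebraic F K ^ (finrank F K - n))]
  have : ∀ z : K, (FiniteField.frobeniusAlgEquivOfAlgebraic F K ^ (finrank F K - n)) z =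
      z ^ Fintype.card F ^ (finrank F K - n) := fun z => by
    rw [AlgEquiv.coe_pow, FiniteField.coe_frobeniusAlgEquivOfAlgebraic_iterate]
  rw [this, mul_pow, ← pow_mul, ← pow_add, Nat.add_sub_cancel' hn, ← card_eq_card_pow_finrank,
    FiniteField.pow_card, mul_comm]

variable {ℓ : Fin s → ℕ}

theorem eq_zero_of_traceForm_eq_zero (hinj : Function.Injective ℓ) (hpos : ∀ j, 1 ≤ ℓ j)
    (hlt : ∀ j, 2 * ℓ j < finrank F K) {a : Fin s → K}
    (h : ∀ x, traceForm F (linearizedPoly (Fintype.card F) ℓ a) x = 0) : a = 0 := by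
  set q := Fintype.card F with hq
  set m := finrank F K with hm
  have hq1 : 1 < q := Fintype.one_lt_card
  -- The polar form of `Q_R` is `(x, y) ↦ Tr(y G(x))`: moving the Frobenius powers off `y` produces
  -- the exponents `q^(m - ℓⱼ)`.
  let G : K[X] := ∑ j, (C (a j) * X ^ q ^ ℓ j + C (a j ^ q ^ (m - ℓ j)) * X ^ q ^ (m - ℓ j))
  have hG : ∀ x, G.eval x = 0 := by
    intro x
    apply (traceForm_nondegenerate F K).1
    intro y
    have hadd := h (x + y)
    have hx := h x
    have hy := h y
    simp only [traceForm] at hadd hx hy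
    rw [eval_linearizedPoly_add] at hadd
    have hpolar : Algebra.trace F K (y * (linearizedPoly q ℓ a).eval x) +
        Algebra.trace F K (x * (linearizedPoly q ℓ a).eval y) = 0 := by
      rw [add_mul, mul_add, mul_add, map_add, map_add, map_add] at hadd
      linear_combination hadd - hx - hy
    have h2 : Algebra.trace F K (x * (linearizedPoly q ℓ a).eval y) =
        Algebra.trace F K (y * ∑ j, a j ^ q ^ (m - ℓ j) * x ^ q ^ (m - ℓ j)) := by
      rw [eval_linearizedPoly, Finset.mul_sum, Finset.mul_sum, map_sum, map_sum]
      refine Finset.sum_congr rfl fun j _ => ?_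
      have := trace_mul_pow_card_pow (F := F) (n := ℓ j) (by have := hlt j; omega) (x * a j) y
      rw [← mul_assoc, this, mul_pow, mul_comm (x ^ _)]
    rw [Algebra.traceForm_apply, mul_comm, ← hpolar, h2, ← map_add, ← mul_add]
    simp [G, eval_finsetSum, eval_linearizedPoly, Finset.sum_add_distrib]
  have hpow : ∀ n < m, q ^ n < q ^ m := fun n hn => Nat.pow_lt_pow_right hq1 hn
  have hG0 : G = 0 := by
    refine eq_zero_of_natDegree_lt_card_of_eval_eq_zero G Function.injective_id hG ?_
    rw [card_eq_card_pow_finrank (F := F) (K := K)]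
    refine lt_of_le_of_lt (natDegree_sum_le_of_forall_le (n := q ^ m - 1) _ _ fun j _ => ?_)
      (Nat.sub_lt (by positivity) one_pos)
    have := hlt j
    have := hpow (ℓ j) (by omega)
    have := hpos j
    have := hpow (m - ℓ j) (by omega)
    refine (natDegree_add_le _ _).trans (max_le ?_ ?_)
    · exact (natDegree_C_mul_X_pow_le _ _).trans (by omega)
    · exact (natDegree_C_mul_X_pow_le _ _).trans (by omega)
  funext i
  have hc := congrArg (fun p => p.coeff (q ^ ℓ i)) hG0
  simp only [G, finsetSum_coeff, coeff_add, coeff_C_mul, coeff_X_pow, coeff_zero] at hc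
  have h1 : ∀ j, q ^ ℓ i = q ^ ℓ j ↔ i = j := fun j =>
    (Nat.pow_right_injective hq1).eq_iff.trans hinj.eq_iff
  -- Equality would give `ℓ i + ℓ j = m`, but both are below `m/2`. So the coefficient of `G` at
  -- `q^ℓᵢ` is just `a i`.
  have h2 : ∀ j, q ^ ℓ i ≠ q ^ (m - ℓ j) := fun j hj => by
    have := Nat.pow_right_injective hq1 hj
    have := hlt i
    have := hlt j
    omega
  simpa [h1, h2] using hc

/-- Power sums over `K` vanish for exponents below `q^m - 1`, and `q^ℓⱼ + 1` is such an exponent. -/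
theorem sum_traceForm_eq_zero (hpos : ∀ j, 1 ≤ ℓ j) (hlt : ∀ j, 2 * ℓ j < finrank F K)
    (a : Fin s → K) : ∑ x, traceForm F (linearizedPoly (Fintype.card F) ℓ a) x = 0 := by
  simp only [traceForm, eval_linearizedPoly]
  rw [← map_sum]
  simp only [Finset.mul_sum]
  rw [Finset.sum_comm, Finset.sum_eq_zero, map_zero]
  intro j _
  have : ∀ x : K, x * (a j * x ^ Fintype.card F ^ ℓ j) = a j * x ^ (Fintype.card F ^ ℓ j + 1) :=
    fun x => by ring
  simp only [this]
  rw [← Finset.mul_sum, FiniteField.sum_pow_lt_card_sub_one, mul_zero]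
  rw [card_eq_card_pow_finrank (F := F) (K := K)]
  have hq1 : 1 < Fintype.card F := Fintype.one_lt_card
  -- From `1 ≤ ℓ j` and `2 * ℓ j < m` follows `ℓ j + 2 ≤ m`, which leaves enough room even for `q =
  -- 2`.
  have h1 : Fintype.card F ^ (ℓ j + 2) ≤ Fintype.card F ^ finrank F K :=
    Nat.pow_le_pow_right (by omega) (by have := hlt j; have := hpos j; omega)
  have h2 : 1 ≤ Fintype.card F ^ ℓ j := Nat.one_le_pow _ _ (by omega)
  have h3 : 4 ≤ Fintype.card F ^ 2 := by nlinarith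
  have h4 : Fintype.card F ^ ℓ j * 4 ≤ Fintype.card F ^ (ℓ j + 2) := by
    rw [pow_add]; exact Nat.mul_le_mul_left _ h3
  omega

theorem sum_eq_zero_add_sum_units {K : Type*} [Field K] [Fintype K] [DecidableEq K] {M : Type*} [AddCommMonoid M] (f : K → M) :
    ∑ x, f x = f 0 + ∑ x : Kˣ, f x := by
  rw [← Finset.add_sum_erase Finset.univ f (Finset.mem_univ 0)]
  congr 1
  symm
  refine Finset.sum_nbij (fun x : Kˣ => (x : K)) (by simp) (fun x _ y _ h => Units.ext h) ?_
    (fun _ _ => rfl)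
  intro x hx
  have : x ≠ 0 := by simpa using hx
  exact ⟨Units.mk0 x this, by simp⟩

theorem encode_injective (hinj : Function.Injective ℓ) (hpos : ∀ j, 1 ≤ ℓ j)
    (hlt : ∀ j, 2 * ℓ j < finrank F K) :
    Function.Injective (encode F (K := K) (Fintype.card F) ℓ) := by
  classical
  rw [← LinearMap.ker_eq_bot, LinearMap.ker_eq_bot']
  rintro ⟨a, b⟩ h
  have h1 : ∀ x : Kˣ, traceForm F (linearizedPoly (Fintype.card F) ℓ a) x = -b := fun x =>
    eq_neg_of_add_eq_zero_left (congrFun h x)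
  -- The form equals `-b` at all `q^m - 1` units and `0` at the origin, so its vanishing sum over
  -- `K` equals `-(q^m - 1) b = b` in `F`.
  have hb : b = 0 := by
    have := sum_traceForm_eq_zero hpos hlt a
    rw [sum_eq_zero_add_sum_units, traceForm_zero_right] at this
    simp only [h1] at this
    rw [Finset.sum_const, Finset.card_univ, Fintype.card_units, zero_add, smul_neg, neg_eq_zero,
      nsmul_eq_mul, Nat.cast_sub Fintype.card_pos, card_eq_card_pow_finrank (F := F) (K := K)] at this
    have hm : finrank F K ≠ 0 := finrank_pos.ne'
    simpa [FiniteField.cast_card_eq_zero, hm] using this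
  have ha : a = 0 := by
    refine eq_zero_of_traceForm_eq_zero hinj hpos hlt fun x => ?_
    by_cases hx : x = 0
    · rw [hx, traceForm_zero_right]
    · simpa [hb] using h1 (Units.mk0 x hx)
  rw [ha, hb]
  rfl

end Parametrization

/-! ### Cyclicity. -/

section Cyclic

variable {F K : Type*} [Field F] [Field K]

/-- The cyclic shift lowers the exponent by one; the wrap-around from `0` to `n - 1` is absorbed by
`α ^ n = 1`. -/
theorem pow_finRotate_symm {G : Type*} [Group G] {α : G} {n : ℕ} (hα : α ^ n = 1) (i : Fin n) :
    α ^ ((finRotate n).symm i : ℕ) = α⁻¹ * α ^ (i : ℕ) := by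
  obtain ⟨j, rfl⟩ := (finRotate n).surjective i
  have := j.neZero
  rw [Equiv.symm_apply_apply, finRotate_apply, Fin.val_add, ← pow_eq_pow_mod _ hα, pow_add,
    Fin.val_one', ← pow_eq_pow_mod _ hα, pow_one, pow_mul_comm', inv_mul_cancel_left]

theorem isCyclicCode_orderBy [Algebra F K] {α : Kˣ} {n : ℕ} (hα : α ^ n = 1)
    {C : Submodule F (Kˣ → F)} (hC : ∀ c ∈ C, (fun x => c (α⁻¹ * x)) ∈ C) :
    IsCyclicCode (orderBy F α n C) := by
  rintro _ ⟨c, hc, rfl⟩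
  refine ⟨_, hC c hc, ?_⟩
  ext i
  simp only [LinearMap.funLeft_apply, pow_finRotate_symm hα]

variable [Algebra F K] {s : ℕ}

/-- Each monomial `x · x^(q^ℓⱼ)` is an eigenvector of the substitution `x ↦ βx`, so the family is
preserved. -/
theorem encode_mul_left (q : ℕ) (ℓ : Fin s → ℕ) (β : Kˣ) (a : Fin s → K) (b : F) :
    (fun x => encode F q ℓ (a, b) (β * x)) =
      encode F q ℓ (fun j => a j * (β * (β : K) ^ q ^ ℓ j), b) := by
  ext x
  simp only [encode_apply, traceForm, eval_linearizedPoly, Units.val_mul, Finset.mul_sum]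
  congr 2
  refine Finset.sum_congr rfl fun j _ => ?_
  ring

theorem code_mul_left_mem {q : ℕ} {ℓ : Fin s → ℕ} (β : Kˣ) {c : Kˣ → F}
    (hc : c ∈ code F (linearizedFamily K q ℓ)) :
    (fun x => c (β * x)) ∈ code F (linearizedFamily K q ℓ) := by
  rw [← range_encode_inl] at hc ⊢
  obtain ⟨a, rfl⟩ := hc
  exact ⟨_, (encode_mul_left q ℓ β a 0).symm⟩

theorem code₀_mul_left_mem {q : ℕ} {ℓ : Fin s → ℕ} (β : Kˣ) {c : Kˣ → F}
    (hc : c ∈ code₀ F (linearizedFamily K q ℓ)) :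
    (fun x => c (β * x)) ∈ code₀ F (linearizedFamily K q ℓ) := by
  rw [← range_encode] at hc ⊢
  obtain ⟨⟨a, b⟩, rfl⟩ := hc
  exact ⟨_, (encode_mul_left q ℓ β a b).symm⟩

end Cyclic

/-! ### Hamming weights from fibre sizes. -/

section Weights

variable {F K : Type*} [Field F] [Field K] [Fintype K] [DecidableEq F] [DecidableEq K]

/-- The final correction removes the coordinate `x = 0`, where the value is `c` and so counts only
when `c ≠ 0`. -/
theorem hammingNorm_units_eq {Q : K → F} (hQ : Q 0 = 0) (c : F) :
    (hammingNorm (fun x : Kˣ => Q x + c) : ℤ) = Fintype.card K -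
      ∑ x, (if Q x = -c then (1 : ℤ) else 0) - if c = 0 then 0 else 1 := by
  have h1 := sum_eq_zero_add_sum_units (fun x : K => if Q x = -c then (0 : ℤ) else 1)
  have h2 : (hammingNorm (fun x : Kˣ => Q x + c) : ℤ) =
      ∑ x : Kˣ, if Q x = -c then (0 : ℤ) else 1 := by
    rw [hammingNorm, Finset.card_filter, Nat.cast_sum]
    refine Finset.sum_congr rfl fun x _ => ?_
    by_cases h : Q x = -c
    · simp [h]
    · simp [h, add_eq_zero_iff_eq_neg]
  have h3 : ∑ x : K, (if Q x = -c then (0 : ℤ) else 1) =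
      Fintype.card K - ∑ x, (if Q x = -c then (1 : ℤ) else 0) := by
    rw [eq_sub_iff_add_eq, ← Finset.sum_add_distrib, Finset.sum_congr rfl (g := fun _ => 1)]
    · simp
    · intro x _
      split_ifs <;> simp
  rw [h2, ← h3, h1, hQ]
  by_cases hc : c = 0
  · simp [hc]
  · simp [hc, eq_comm]

variable [Fintype F] [Algebra F K]

/-- The excess is written with exponent `e + 1` because its definition multiplies fibre sizes by
`q`; cancelling that factor leaves `q^e`. -/
theorem HasExcess.hammingNorm_units {Q : K → F} (hQ : Q 0 = 0) {ε : ℤ} {e : ℕ}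
    (h : HasExcess Q (ε * (Fintype.card F : ℤ) ^ (e + 1))) (c : F) :
    (hammingNorm (fun x : Kˣ => Q x + c) : ℤ) =
      (Fintype.card F : ℤ) ^ finrank F K - (Fintype.card F : ℤ) ^ (finrank F K - 1) +
        if c = 0 then -ε * ((Fintype.card F : ℤ) - 1) * (Fintype.card F : ℤ) ^ e
        else ε * (Fintype.card F : ℤ) ^ e - 1 := by
  have hq : (Fintype.card F : ℤ) ≠ 0 := by exact_mod_cast Fintype.card_ne_zero
  have hK : (Fintype.card K : ℤ) =
      (Fintype.card F : ℤ) * (Fintype.card F : ℤ) ^ (finrank F K - 1) := by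
    rw [card_eq_card_pow_finrank (F := F), Nat.cast_pow, ← pow_succ',
      Nat.sub_add_cancel finrank_pos]
  have hK' : (Fintype.card K : ℤ) = (Fintype.card F : ℤ) ^ finrank F K := by
    rw [card_eq_card_pow_finrank (F := F), Nat.cast_pow]
  have h1 := h (-c)
  rw [hammingNorm_units_eq hQ, ← hK']
  have h2 : ∑ x, (if Q x = -c then (1 : ℤ) else 0) = (Fintype.card F : ℤ) ^ (finrank F K - 1) -
      ε * (Fintype.card F : ℤ) ^ e +
        if c = 0 then (Fintype.card F : ℤ) * (ε * (Fintype.card F : ℤ) ^ e) else 0 := by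
    apply mul_left_cancel₀ hq
    rw [h1, hK]
    simp only [neg_eq_zero]
    split_ifs <;> ring
  rw [h2]
  split_ifs <;> ring

end Weights

/-! ### Summation over ranks and types. -/

section Distribution

variable {F K : Type*} [Field F] [Field K]

theorem linearizedPoly_injective {s q : ℕ} {ℓ : Fin s → ℕ} (hq : 1 < q) (hinj : Function.Injective ℓ) :
    Function.Injective (linearizedPoly (K := K) q ℓ) := by
  intro a b h
  funext i
  have hc := congrArg (fun p => p.coeff (q ^ ℓ i)) h
  have h1 : ∀ j, q ^ ℓ i = q ^ ℓ j ↔ i = j := fun j =>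
    (Nat.pow_right_injective hq).eq_iff.trans hinj.eq_iff
  simpa [linearizedPoly, finsetSum_coeff, coeff_X_pow, h1] using hc

theorem frequency_range [DecidableEq F] {M : Type*} [AddCommGroup M] [Module F M] [Fintype M]
    {ι : Type*} [Fintype ι] {Φ : M →ₗ[F] (ι → F)} (hΦ : Function.Injective Φ) (w : ℕ) :
    frequency (LinearMap.range Φ) w = ∑ a, if hammingNorm (Φ a) = w then 1 else 0 := by
  classical
  have : {c : ι → F | c ∈ LinearMap.range Φ ∧ hammingNorm c = w} =
      Φ '' {a | hammingNorm (Φ a) = w} := by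
    ext c
    constructor
    · rintro ⟨⟨a, rfl⟩, h⟩
      exact ⟨a, h, rfl⟩
    · rintro ⟨a, h, rfl⟩
      exact ⟨⟨a, rfl⟩, h⟩
  rw [frequency, this, Set.ncard_image_of_injective _ hΦ, Set.ncard_eq_toFinset_card',
    ← Finset.card_filter]
  congr 1
  ext a
  simp

variable [Algebra F K]

theorem mem_rankSet [FiniteDimensional F K] {L : Submodule K K[X]} {R : K[X]} (hR : R ∈ L) {r : ℕ}
    (hr : HasRank (traceForm F R) r) : r ∈ rankSet F L := by
  classical
  have := hr.le_finrank
  simp only [rankSet, Finset.mem_filter, Finset.mem_range]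
  exact ⟨by omega, R, hR, hr⟩

variable [Fintype F] [Fintype K] [DecidableEq F] [DecidableEq K]

/-- In an even rank family, a nonzero `R` has exactly one rank and type, and these determine the
weights of the words `Tr(x R(x)) + c`. -/
theorem exists_rank_type {L : Submodule K K[X]} (heven : IsEvenRankFamily F L) {R : K[X]}
    (hR : R ∈ L) (hR0 : R ≠ 0) :
    ∃ r ∈ rankSet F L, ∃ i ∈ ({1, 2} : Finset ℕ),
      (∀ r' i', R ∈ rankTypeSet F L r' i' ↔ r' = r ∧ i' = i) ∧
      (∀ c : F, (hammingNorm (fun x : Kˣ => traceForm F R x + c) : ℤ) =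
        if c = 0 then (Fintype.card F : ℤ) ^ finrank F K - (Fintype.card F : ℤ) ^ (finrank F K - 1)
          + (-1) ^ i * ((Fintype.card F : ℤ) - 1) *
            (Fintype.card F : ℤ) ^ (finrank F K - r / 2 - 1)
        else (Fintype.card F : ℤ) ^ finrank F K - (Fintype.card F : ℤ) ^ (finrank F K - 1)
          + (-1) ^ (i + 1) * (Fintype.card F : ℤ) ^ (finrank F K - r / 2 - 1) - 1) := by
  obtain ⟨r, hr, hrank⟩ := heven R hR
  have hle := hrank.le_finrank
  have hpos : 0 < finrank F K := finrank_pos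
  -- Since `r ≤ m` and `0 < m`, `r / 2 < m`, so the truncated subtraction is exact.
  have hexp : finrank F K - r / 2 = finrank F K - r / 2 - 1 + 1 := by omega
  refine ⟨r, mem_rankSet hR hrank, ?_⟩
  rcases hrank.type_and_excess hr with ⟨hty, hex⟩ | ⟨hty, hex⟩
  · refine ⟨1, by simp, fun r' i' => ⟨?_, ?_⟩, fun c => ?_⟩
    · rintro ⟨-, -, h1, h2⟩
      refine ⟨h1.unique hrank, ?_⟩
      rcases h2 with ⟨rfl, -⟩ | ⟨-, h3⟩
      · rfl
      · exact absurd h3 (not_isEllipticType_of_isHyperbolicType hty)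
    · rintro ⟨rfl, rfl⟩
      exact ⟨hR, hR0, hrank, Or.inl ⟨rfl, hty⟩⟩
    · rw [hexp, ← one_mul ((Fintype.card F : ℤ) ^ _)] at hex
      rw [hex.hammingNorm_units (traceForm_zero_right R) c]
      split_ifs <;> ring
  · refine ⟨2, by simp, fun r' i' => ⟨?_, ?_⟩, fun c => ?_⟩
    · rintro ⟨-, -, h1, h2⟩
      refine ⟨h1.unique hrank, ?_⟩
      rcases h2 with ⟨-, h3⟩ | ⟨rfl, -⟩
      · exact absurd hty (not_isEllipticType_of_isHyperbolicType h3)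
      · rfl
    · rintro ⟨rfl, rfl⟩
      exact ⟨hR, hR0, hrank, Or.inr ⟨rfl, hty⟩⟩
    · rw [hexp, neg_eq_neg_one_mul] at hex
      rw [hex.hammingNorm_units (traceForm_zero_right R) c]
      split_ifs <;> ring

theorem hammingNorm_of_mem_rankTypeSet {L : Submodule K K[X]} (heven : IsEvenRankFamily F L)
    {R : K[X]} {r i : ℕ} (hR : R ∈ rankTypeSet F L r i) (c : F) :
    (hammingNorm (fun x : Kˣ => traceForm F R x + c) : ℤ) =
      if c = 0 then (Fintype.card F : ℤ) ^ finrank F K - (Fintype.card F : ℤ) ^ (finrank F K - 1)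
        + (-1) ^ i * ((Fintype.card F : ℤ) - 1) * (Fintype.card F : ℤ) ^ (finrank F K - r / 2 - 1)
      else (Fintype.card F : ℤ) ^ finrank F K - (Fintype.card F : ℤ) ^ (finrank F K - 1)
        + (-1) ^ (i + 1) * (Fintype.card F : ℤ) ^ (finrank F K - r / 2 - 1) - 1 := by
  obtain ⟨r', -, i', -, h1, h2⟩ := exists_rank_type heven hR.1 hR.2.1
  obtain ⟨rfl, rfl⟩ := (h1 r i).1 hR
  exact h2 c

variable {s : ℕ} {ℓ : Fin s → ℕ}

/-- Sums over the nonzero `R` of a quantity `f` depending only on the rank and the type of `Q_R`. -/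
theorem sum_rankTypeCount (hinj : Function.Injective ℓ)
    (heven : IsEvenRankFamily F (linearizedFamily K (Fintype.card F) ℓ))
    (f : (Fin s → K) → ℕ) (g : ℕ → ℕ → ℕ)
    (hfg : ∀ a r i, linearizedPoly (Fintype.card F) ℓ a ∈
      rankTypeSet F (linearizedFamily K (Fintype.card F) ℓ) r i → f a = g r i) :
    ∑ a, f a = f 0 + ∑ r ∈ rankSet F (linearizedFamily K (Fintype.card F) ℓ),
      ∑ i ∈ ({1, 2} : Finset ℕ),
        g r i * rankTypeCount F (linearizedFamily K (Fintype.card F) ℓ) r i := by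
  classical
  have hΦ := linearizedPoly_injective (K := K) (ℓ := ℓ) (Fintype.one_lt_card (α := F)) hinj
  have hcount : ∀ r i, rankTypeCount F (linearizedFamily K (Fintype.card F) ℓ) r i =
      ∑ a ∈ Finset.univ.erase 0, if linearizedPoly (Fintype.card F) ℓ a ∈
        rankTypeSet F (linearizedFamily K (Fintype.card F) ℓ) r i then 1 else 0 := by
    intro r i
    have himage : rankTypeSet F (linearizedFamily K (Fintype.card F) ℓ) r i =
        linearizedPoly (Fintype.card F) ℓ '' {a | linearizedPoly (Fintype.card F) ℓ a ∈
        rankTypeSet F (linearizedFamily K (Fintype.card F) ℓ) r i} := by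
      refine Set.Subset.antisymm (fun R hR => ?_) (Set.image_subset_iff.2 fun a ha => ha)
      obtain ⟨a, rfl⟩ := mem_linearizedFamily.1 hR.1
      exact ⟨a, hR, rfl⟩
    rw [rankTypeCount, ← Finset.card_filter, himage, Set.ncard_image_of_injective _ hΦ,
      Set.ncard_eq_toFinset_card', ← himage]
    congr 1
    ext a
    simp only [Set.mem_toFinset, Set.mem_ofPred_eq, Finset.mem_filter, Finset.mem_erase,
      Finset.mem_univ, and_true, iff_and_self]
    rintro h rfl
    exact h.2.1 (linearizedPoly_zero _ _)
  rw [← Finset.add_sum_erase Finset.univ f (Finset.mem_univ 0)]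
  congr 1
  simp only [hcount, Finset.mul_sum]
  rw [Finset.sum_congr rfl fun r _ => Finset.sum_comm, Finset.sum_comm]
  refine Finset.sum_congr rfl fun a ha => ?_
  have ha0 : linearizedPoly (Fintype.card F) ℓ a ≠ 0 := fun h =>
    Finset.ne_of_mem_erase ha (hΦ (h.trans (linearizedPoly_zero _ _).symm))
  -- Each nonzero `a` lies in exactly one rank-and-type class, so a single term of the double sum
  -- survives.
  obtain ⟨r, hr, i, hi, hmem, -⟩ := exists_rank_type heven (mem_linearizedFamily.2 ⟨a, rfl⟩) ha0
  rw [hfg a r i ((hmem r i).2 ⟨rfl, rfl⟩)]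
  simp only [hmem]
  rw [Finset.sum_eq_single_of_mem r hr, Finset.sum_eq_single_of_mem i hi]
  · simp
  · intro i' _ hi'
    simp [hi']
  · intro r' _ hr'
    simp [hr']

end Distribution

end TraceCode

/-! ### The main theorem. -/

theorem theorem3p3 {F K : Type*} [Field F] [Field K] [Algebra F K]
    [Fintype F] [Fintype K] [DecidableEq F] [DecidableEq K]
    (q m s : ℕ) (hq : Fintype.card F = q) (hm : Module.finrank F K = m)
    (ℓ : Fin s → ℕ) (hmono : StrictMono ℓ)
    (hpos : ∀ j, 1 ≤ ℓ j) (hlt : ∀ j, 2 * ℓ j < m)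
    (L : Submodule K (Polynomial K)) (hL : L = TraceCode.linearizedFamily K q ℓ)
    (heven : TraceCode.IsEvenRankFamily F L) :
    -- both codes are cyclic codes of length `q ^ m - 1`
    (∀ α : Kˣ, (∀ x : Kˣ, x ∈ Subgroup.zpowers α) →
      TraceCode.IsCyclicCode (TraceCode.orderBy F α (q ^ m - 1) (TraceCode.code F L)) ∧
      TraceCode.IsCyclicCode (TraceCode.orderBy F α (q ^ m - 1) (TraceCode.code₀ F L))) ∧
    -- dimensions
    Module.finrank F (TraceCode.code F L) = m * s ∧
    Module.finrank F (TraceCode.code₀ F L) = m * s + 1 ∧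
    -- weight distribution of `C_L`; rows of equal weight are added up
    (∀ w : ℕ, TraceCode.frequency (TraceCode.code F L) w =
      (if w = 0 then 1 else 0) +
      ∑ r ∈ TraceCode.rankSet F L, ∑ i ∈ ({1, 2} : Finset ℕ),
        (if (w : ℤ) = (q : ℤ) ^ m - (q : ℤ) ^ (m - 1)
              + (-1) ^ i * ((q : ℤ) - 1) * (q : ℤ) ^ (m - r / 2 - 1)
          then TraceCode.rankTypeCount F L r i else 0)) ∧
    -- weight distribution of `C_{L,0}`; rows of equal weight are added up
    (∀ w : ℕ, TraceCode.frequency (TraceCode.code₀ F L) w =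
      (if w = 0 then 1 else 0) +
      (if w = q ^ m - 1 then q - 1 else 0) +
      ∑ r ∈ TraceCode.rankSet F L, ∑ i ∈ ({1, 2} : Finset ℕ),
        ((if (w : ℤ) = (q : ℤ) ^ m - (q : ℤ) ^ (m - 1)
              + (-1) ^ i * ((q : ℤ) - 1) * (q : ℤ) ^ (m - r / 2 - 1)
          then TraceCode.rankTypeCount F L r i else 0) +
         (if (w : ℤ) = (q : ℤ) ^ m - (q : ℤ) ^ (m - 1)
              + (-1) ^ (i + 1) * (q : ℤ) ^ (m - r / 2 - 1) - 1
          then TraceCode.rankTypeCount F L r i * (q - 1) else 0))) := by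
  subst hq hm hL
  have hinj := hmono.injective
  have hE := TraceCode.encode_injective (F := F) (K := K) hinj hpos hlt
  have hE' : Function.Injective (TraceCode.encode F (K := K) (Fintype.card F) ℓ ∘ₗ
      LinearMap.inl F (Fin s → K) F) := hE.comp LinearMap.inl_injective
  have hcardK : Fintype.card K = Fintype.card F ^ Module.finrank F K :=
    TraceCode.card_eq_card_pow_finrank
  -- The words with `R = 0` are the constants; they give the rows of weight `0` and `q^m - 1`.
  have hwt0 : ∀ c : F, hammingNorm (TraceCode.encode F (K := K) (Fintype.card F) ℓ (0, c)) =
      if c = 0 then 0 else Fintype.card F ^ Module.finrank F K - 1 := by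
    intro c
    have h1 : TraceCode.encode F (K := K) (Fintype.card F) ℓ (0, c) = fun _ => c := by
      ext x
      simp [TraceCode.encode_apply, TraceCode.linearizedPoly_zero, TraceCode.traceForm]
    rw [h1, ← hcardK, ← Fintype.card_units, hammingNorm]
    by_cases hc : c = 0 <;> simp [hc]
  have hcyc : ∀ α : Kˣ, α ^ (Fintype.card F ^ Module.finrank F K - 1) = 1 := by
    intro α
    rw [← hcardK, ← Fintype.card_units, pow_card_eq_one]
  -- For fixed `R`, the weight depends on `c` only through whether `c = 0`; this is the source of
  -- the factors `q - 1`.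
  have hsplit : ∀ h : F → ℕ, ∀ u v : ℕ, (∀ c, h c = if c = 0 then u else v) →
      ∑ c, h c = u + (Fintype.card F - 1) * v := by
    intro h u v hh
    rw [← Finset.add_sum_erase Finset.univ h (Finset.mem_univ 0),
      Finset.sum_congr rfl (g := fun _ => v)]
    · simp [hh, Finset.card_erase_of_mem]
    · intro c hc
      simp [hh, Finset.ne_of_mem_erase hc]
  refine ⟨fun α _ => ⟨?_, ?_⟩, ?_, ?_, fun w => ?_, fun w => ?_⟩
  · exact TraceCode.isCyclicCode_orderBy (hcyc α) fun c => TraceCode.code_mul_left_mem _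
  · exact TraceCode.isCyclicCode_orderBy (hcyc α) fun c => TraceCode.code₀_mul_left_mem _
  · rw [← TraceCode.range_encode_inl, LinearMap.finrank_range_of_inj hE', Module.finrank_pi_fintype]
    simp [mul_comm]
  · rw [← TraceCode.range_encode, LinearMap.finrank_range_of_inj hE, Module.finrank_prod, Module.finrank_pi_fintype]
    simp [mul_comm]
  · rw [← TraceCode.range_encode_inl, TraceCode.frequency_range hE',
      TraceCode.sum_rankTypeCount hinj heven _ (fun r i =>
        if (w : ℤ) = (Fintype.card F : ℤ) ^ Module.finrank F K -
            (Fintype.card F : ℤ) ^ (Module.finrank F K - 1)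
              + (-1) ^ i * ((Fintype.card F : ℤ) - 1) *
                (Fintype.card F : ℤ) ^ (Module.finrank F K - r / 2 - 1) then 1 else 0)]
    · simp only [LinearMap.comp_apply, LinearMap.inl_apply, hwt0, if_true, ite_mul, one_mul,
        zero_mul, eq_comm (a := w)]
    · intro a r i hR
      simp only [LinearMap.comp_apply, LinearMap.inl_apply]
      have := TraceCode.hammingNorm_of_mem_rankTypeSet heven hR 0
      rw [if_pos rfl] at this
      rw [← this]
      simp only [Nat.cast_inj, eq_comm]
      rfl
  · rw [← TraceCode.range_encode, TraceCode.frequency_range hE, Fintype.sum_prod_type,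
      TraceCode.sum_rankTypeCount hinj heven _ (fun r i =>
        (if (w : ℤ) = (Fintype.card F : ℤ) ^ Module.finrank F K -
            (Fintype.card F : ℤ) ^ (Module.finrank F K - 1)
              + (-1) ^ i * ((Fintype.card F : ℤ) - 1) *
                (Fintype.card F : ℤ) ^ (Module.finrank F K - r / 2 - 1) then 1 else 0) +
        (Fintype.card F - 1) * if (w : ℤ) = (Fintype.card F : ℤ) ^ Module.finrank F K -
            (Fintype.card F : ℤ) ^ (Module.finrank F K - 1)
              + (-1) ^ (i + 1) *
                (Fintype.card F : ℤ) ^ (Module.finrank F K - r / 2 - 1) - 1 then 1 else 0)]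
    · congr 1
      · rw [hsplit _ (if w = 0 then 1 else 0)
          (if w = Fintype.card F ^ Module.finrank F K - 1 then 1 else 0)]
        · simp
        · intro c
          rw [hwt0]
          by_cases hc : c = 0 <;> simp [hc, eq_comm]
      · refine Finset.sum_congr rfl fun r _ => Finset.sum_congr rfl fun i _ => ?_
        rw [add_mul]
        congr 1
        · simp
        · split_ifs <;> ring
    · intro a r i hR
      refine hsplit _ _ _ fun c => ?_
      have := TraceCode.hammingNorm_of_mem_rankTypeSet heven hR c
      by_cases hc : c = 0
      · rw [if_pos hc] at this ⊢
        rw [← this]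
        simp only [Nat.cast_inj, eq_comm]
        rfl
      · rw [if_neg hc] at this ⊢
        rw [← this]
        simp only [Nat.cast_inj, eq_comm]
        rfl
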